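/- \textbf{Theorem.} Consider one-pass randomized streaming algorithms that are first given an integer $\kappa$ and then an insertion-only stream listing, in arbitrary order and each exactly once, the edges of a simple graph $G$ on the vertex set $\{1,\dots,n\}$ whose degeneracy is $\kappa$ (the degeneracy of $G$ is the least $k$ such that every nonempty induced subgraph of $G$ has a vertex of degree at most $k$). For a nonnegative integer $\lambda$, possibly depending on $n$ and $\kappa$, we say that such an algorithm $(\kappa+\lambda)$-colours $n$-vertex graphs if, for every $\kappa$, every $G$ of degeneracy $\kappa$ on $\{1,\dots,n\}$ and every ordering of its edges, it outputs with probability at least $2/3$ a proper colouring of $G$ with colours from a palette of $\kappa+\lambda$ colours. The space of the algorithm is the number of bits of memory carried from one stream element to the next; its computing power, its access to $\kappa$, $n$, the position in the stream, and its access to a random seed are unrestricted. (1) There is an absolute constant $c>0$ such that for all integers $\lambda\ge 1$ and $n\ge 5\lambda$, every such algorithm that $(\kappa+\lambda)$-colours $n$-vertex graphs uses at least $c\,n^2/\lambda^2$ bits of space. (2) Let $\gamma>0$ and let $\lambda=\lambda(n,\kappa)$ be nonnegative integers with $\lambda(n,\kappa)=O(\kappa^{1/2-\gamma})$, that is, there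 are $K$ and $\kappa_0$ with $\lambda(n,\kappa)\le K\kappa^{1/2-\gamma}$ for all $n$ and all $\kappa\ge\kappa_0$. Then there is no semi-streaming algorithm for $(\kappa+\lambda(n,\kappa))$-colouring: there is no family $(A_n)_{n\ge 0}$ such that $A_n$ $(\kappa+\lambda(n,\kappa))$-colours $n$-vertex graphs for every $n$ and $A_n$ uses $s(n)$ bits of space with $s(n)=O(n\log^d n)$ for some constant $d$. -/

import Mathlib

open MeasureTheory

universe u

namespace StreamColoring

/-- `G` is `k`-degenerate: every (nonempty) induced subgraph has a vertex of degree at most `k`. -/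
def IsDegenerate {V : Type*} (G : SimpleGraph V) (k : ℕ) : Prop :=
  ∀ S : Set V, S.Nonempty → ∃ v : S, ((G.induce S).neighborSet v).encard ≤ k

/-- The degeneracy of a finite graph: the smallest `k` such that `G` is `k`-degenerate. -/
noncomputable def degeneracy {V : Type*} [Finite V] (G : SimpleGraph V) : ℕ :=
  sInf {k : ℕ | IsDegenerate G k}

/-- `f` is a proper `c`-colouring of `G`, with palette `{0, …, c - 1}`. -/
def IsProperColoring {V : Type*} (G : SimpleGraph V) (c : ℕ) (f : V → ℕ) : Prop :=
  (∀ v, f v < c) ∧ ∀ u v, G.Adj u v → f u ≠ f v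

/-- `σ` is an insertion-only stream building up `G`: it lists every edge of `G` exactly once,
in some order. -/
def IsEdgeStream {V : Type*} (G : SimpleGraph V) (σ : List (Sym2 V)) : Prop :=
  σ.Nodup ∧ ∀ e, e ∈ σ ↔ e ∈ G.edgeSet

/-- A deterministic one-pass algorithm on streams of edges of graphs on the vertex set `Fin n`
whose memory consists of `s` bits, and which outputs a colour for each vertex. It is told an
integer `k` before the stream starts. The memory is initialised, then rewritten once for every
edge of the stream, and the output is computed from its final content. The model is
non-uniform: no bound is put on computing power, and the integer `k` and the position `t` in the
stream can be consulted for free at any time. -/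
structure DetAlgorithm (n s : ℕ) where
  init : (k : ℕ) → (Fin s → Bool)
  step : (k t : ℕ) → (Fin s → Bool) → Sym2 (Fin n) → (Fin s → Bool)
  output : (k : ℕ) → (Fin s → Bool) → (Fin n → ℕ)

/-- The colouring output by a deterministic algorithm on the input `k` followed by the
stream `σ`. -/
def DetAlgorithm.run {n s : ℕ} (A : DetAlgorithm n s) (k : ℕ) (σ : List (Sym2 (Fin n))) :
    Fin n → ℕ :=
  A.output k (σ.zipIdx.foldl (fun q e => A.step k e.2 q e.1) (A.init k))

/-- A randomized one-pass algorithm with `s` bits of memory: a random choice of a deterministic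
one, such that the output on each input is a random variable. The random seed can be consulted
for free at any time. (Algorithms that toss fresh private coins at every step are included:
the seed then consists of independent coins for each position `t` of the stream.) -/
structure RandAlgorithm (n s : ℕ) where
  Seed : Type u
  measurableSpace : MeasurableSpace Seed
  μ : Measure Seed
  isProbabilityMeasure : IsProbabilityMeasure μ
  alg : Seed → DetAlgorithm n s
  measurable_run : ∀ (k : ℕ) (σ : List (Sym2 (Fin n))), Measurable fun ω => (alg ω).run k σ

/-- Given the degeneracy `κ` of an arbitrary graph `G` on `Fin n`, followed by the edges of `G` in
arbitrary order, the algorithm outputs a proper `(κ + lam κ)`-colouring of `G` with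
probability at least `2/3`. -/
def RandAlgorithm.Colors {n s : ℕ} (A : RandAlgorithm.{u} n s) (lam : ℕ → ℕ) : Prop :=
  ∀ (G : SimpleGraph (Fin n)) (κ : ℕ), degeneracy G = κ →
    ∀ σ : List (Sym2 (Fin n)), IsEdgeStream G σ →
      letI := A.measurableSpace
      (2 / 3 : ℝ) ≤ A.μ.real {ω | IsProperColoring G (κ + lam κ) ((A.alg ω).run κ σ)}

/-- The space bound `s` is semi-streaming, i.e. `s(n) = O(n · polylog n)`. -/
def IsSemiStreaming (s : ℕ → ℕ) : Prop :=
  ∃ d : ℕ, (fun n : ℕ => (s n : ℝ)) =O[Filter.atTop] fun n : ℕ => (n : ℝ) * Real.log n ^ d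

end StreamColoring

namespace StreamColoring

/-! ### The one-way communication complexity of `INDEX` -/

/-! Both parts reduce from `INDEX`: one party sends an `s`-bit message about a string of `N` bits,
and the other must recover any one queried bit with probability 2/3. Then `s ≥ N / 15`: averaging
fixes the seed so that two thirds of all string-index pairs are decoded correctly. Against one fixed
message, the average of `2 ^ (number of agreements)` over all strings is only `(3 / 2) ^ N`, so a
union over the `2 ^ s` messages and Jensen's inequality force `s` to be linear in `N`. The string
has `p ^ 2` bits, one for each left block and pair of right blocks; the bit decides which block of
the pair is completely joined to the left block. The message is the memory state after these edges.
To query a bit, the second party adds all edges that do not cross sides among the left block, the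
pair and `k` extra vertices. Whatever the string and the query, the degeneracy is `k + 2 * l - 1`,
so the palette with slack `l` has one colour fewer than the `k + 3 * l` relevant vertices. Two of
them share a colour; only the left block and the unjoined block can supply such a pair, and this
reveals the bit. Hence `s ≥ p ^ 2 / 15`. Part (1) takes `p` of order `n / l`. Part (2) takes
degeneracy `m` and `n = 4 * m`, which gives `s` at least of order `m ^ 2 / l ^ 2`, beyond any
semi-streaming bound. -/

theorem sum_two_pow_card_agree {ι : Type*} [Fintype ι] [DecidableEq ι] (y : ι → Bool) :
    ∑ x : ι → Bool, (2 : ℝ) ^ (Finset.univ.filter fun i => y i = x i).card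
      = 3 ^ Fintype.card ι := by
  have h := Finset.prod_univ_sum (fun _ : ι => (Finset.univ : Finset Bool))
    (fun i b => if y i = b then (2 : ℝ) else 1)
  rw [Fintype.piFinset_univ] at h
  calc ∑ x : ι → Bool, (2 : ℝ) ^ (Finset.univ.filter fun i => y i = x i).card
      = ∑ x : ι → Bool, ∏ i, (if y i = x i then (2 : ℝ) else 1) := by
        refine Finset.sum_congr rfl fun x _ => ?_
        rw [Finset.prod_ite]
        simp
    _ = ∏ i : ι, ∑ b : Bool, (if y i = b then (2 : ℝ) else 1) := h.symm
    _ = ∏ _i : ι, (3 : ℝ) := by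
        refine Finset.prod_congr rfl fun i _ => ?_
        cases y i <;> norm_num
    _ = 3 ^ Fintype.card ι := by simp

/-- If the bits of a string of length `N` can be recovered from a message of `s` bits, two thirds
of them on average, then `s ≥ N / 15`. -/
theorem card_div_le_of_agreement {ι : Type*} [Fintype ι] [DecidableEq ι] {s : ℕ}
    (enc : (ι → Bool) → (Fin s → Bool)) (dec : (Fin s → Bool) → ι → Bool)
    (h : (2 / 3 : ℝ) * (Fintype.card ι * 2 ^ Fintype.card ι) ≤
      ∑ x : ι → Bool, ((Finset.univ.filter fun i => dec (enc x) i = x i).card : ℝ)) :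
    (Fintype.card ι : ℝ) / 15 ≤ s := by
  set N := Fintype.card ι with hN
  let agr : (Fin s → Bool) → (ι → Bool) → ℕ := fun q x =>
    (Finset.univ.filter fun i => dec q i = x i).card
  have hupper : ∑ x : ι → Bool, (2 : ℝ) ^ agr (enc x) x ≤ 2 ^ s * 3 ^ N := by
    calc ∑ x : ι → Bool, (2 : ℝ) ^ agr (enc x) x
        ≤ ∑ x : ι → Bool, ∑ q : Fin s → Bool, (2 : ℝ) ^ agr q x :=
          Finset.sum_le_sum fun x _ =>
            Finset.single_le_sum (f := fun q => (2 : ℝ) ^ agr q x)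
              (fun q _ => by positivity) (Finset.mem_univ (enc x))
      _ = ∑ q : Fin s → Bool, ∑ x : ι → Bool, (2 : ℝ) ^ agr q x := Finset.sum_comm
      _ = ∑ _q : Fin s → Bool, (3 : ℝ) ^ N :=
          Finset.sum_congr rfl fun q _ => sum_two_pow_card_agree (dec q)
      _ = 2 ^ s * 3 ^ N := by simp
  -- Jensen for `2 ^ ·` under the uniform distribution on strings.
  have hJ := (convexOn_rpow_left (b := (2 : ℝ)) two_pos).map_sum_le
    (t := (Finset.univ : Finset (ι → Bool))) (w := fun _ => ((2 : ℝ) ^ N)⁻¹)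
    (p := fun x => (agr (enc x) x : ℝ)) (fun _ _ => by positivity)
    (by simp [hN]) (fun _ _ => Set.mem_univ _)
  simp only [smul_eq_mul, Real.rpow_natCast, ← Finset.mul_sum] at hJ
  have hmean : (2 / 3 : ℝ) * N ≤ ((2 : ℝ) ^ N)⁻¹ * ∑ x, (agr (enc x) x : ℝ) := by
    rw [inv_mul_eq_div, le_div_iff₀ (by positivity)]
    linarith
  have h1 : (2 : ℝ) ^ ((2 / 3 : ℝ) * N) ≤ ((2 : ℝ) ^ N)⁻¹ * (2 ^ s * 3 ^ N) :=
    (Real.rpow_le_rpow_of_exponent_le one_le_two hmean).trans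
      (hJ.trans (mul_le_mul_of_nonneg_left hupper (by positivity)))
  -- This is `3 ^ 5 = 243 ≤ 256 = 2 ^ 8`; the final constant is `5 / 3 - 8 / 5 = 1 / 15`.
  have h3 : (3 : ℝ) ^ N ≤ (2 : ℝ) ^ ((8 / 5 : ℝ) * N) := by
    rw [Real.rpow_mul two_pos.le, Real.rpow_natCast]
    refine pow_le_pow_left₀ (by norm_num) ?_ N
    refine le_of_pow_le_pow_left₀ (n := 5) (by norm_num) (by positivity) ?_
    rw [← Real.rpow_natCast ((2 : ℝ) ^ (8 / 5 : ℝ)), ← Real.rpow_mul two_pos.le]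
    norm_num
  have h2 : (2 : ℝ) ^ ((5 / 3 : ℝ) * N) ≤ (2 : ℝ) ^ ((s : ℝ) + (8 / 5 : ℝ) * N) := by
    rw [Real.rpow_add two_pos, Real.rpow_natCast,
      show (5 / 3 : ℝ) * N = N + (2 / 3 : ℝ) * N by ring, Real.rpow_add two_pos,
      Real.rpow_natCast]
    calc (2 : ℝ) ^ N * 2 ^ ((2 / 3 : ℝ) * N)
        ≤ 2 ^ N * (((2 : ℝ) ^ N)⁻¹ * (2 ^ s * 3 ^ N)) := by gcongr
      _ = 2 ^ s * 3 ^ N := by field_simp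
      _ ≤ _ := by gcongr
  have := (Real.rpow_le_rpow_left_iff one_lt_two).1 h2
  linarith

/-- Some outcome lies in at least a `c` fraction of finitely many events, each of
probability at least `c`. -/
theorem exists_le_card_filter_mem {Ω T : Type*} [MeasurableSpace Ω] (μ : Measure Ω)
    [IsProbabilityMeasure μ] [Fintype T] (E : T → Set Ω) (hE : ∀ t, MeasurableSet (E t)) {c : ℝ}
    (h : ∀ t, c ≤ μ.real (E t)) :
    ∃ ω, c * Fintype.card T ≤ ∑ t, (E t).indicator (1 : Ω → ℝ) ω := by
  have hint : ∀ t, Integrable ((E t).indicator (1 : Ω → ℝ)) μ := fun t =>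
    (integrable_const (1 : ℝ)).indicator (hE t)
  obtain ⟨ω, hω⟩ := exists_integral_le (μ := μ)
    (f := fun ω => ∑ t, (E t).indicator (1 : Ω → ℝ) ω) (integrable_finsetSum _ fun t _ => hint t)
  refine ⟨ω, le_trans ?_ hω⟩
  rw [integral_finsetSum _ fun t _ => hint t]
  calc c * Fintype.card T = ∑ _t : T, c := by simp [mul_comm]
    _ ≤ _ := Finset.sum_le_sum fun t _ => by rw [integral_indicator_one (hE t)]; exact h t

/-- A one-way randomized protocol for `INDEX` with shared randomness, in which the output on the
string `x` and the index `i` is correct on the event `E x i`. -/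
theorem card_div_le_of_index_protocol {Ω ι : Type*} [MeasurableSpace Ω] (μ : Measure Ω)
    [IsProbabilityMeasure μ] [Fintype ι] [DecidableEq ι] {s : ℕ}
    (enc : Ω → (ι → Bool) → (Fin s → Bool)) (dec : Ω → (Fin s → Bool) → ι → Bool)
    (E : (ι → Bool) → ι → Set Ω) (hE : ∀ x i, MeasurableSet (E x i))
    (hprob : ∀ x i, (2 / 3 : ℝ) ≤ μ.real (E x i))
    (hdec : ∀ x i, ∀ ω ∈ E x i, dec ω (enc ω x) i = x i) :
    (Fintype.card ι : ℝ) / 15 ≤ s := by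
  obtain ⟨ω, hω⟩ := exists_le_card_filter_mem μ (fun t : (ι → Bool) × ι => E t.1 t.2)
    (fun t => hE t.1 t.2) (fun t => hprob t.1 t.2)
  refine card_div_le_of_agreement (enc ω) (dec ω) ?_
  have hcard : (Fintype.card ((ι → Bool) × ι) : ℝ)
      = Fintype.card ι * 2 ^ Fintype.card ι := by
    simp [mul_comm]
  rw [hcard, Fintype.sum_prod_type] at hω
  refine hω.trans (Finset.sum_le_sum fun x _ => ?_)
  rw [Finset.card_filter, Nat.cast_sum]
  refine Finset.sum_le_sum fun i _ => ?_
  by_cases hi : ω ∈ E x i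
  · simp [hi, hdec x i ω hi]
  · simp only [Set.indicator_of_notMem hi]
    positivity

/-! ### Degeneracy -/

theorem isDegenerate_of_forall {V : Type*} {G : SimpleGraph V} {k : ℕ}
    (h : ∀ S : Set V, S.Nonempty →
      ∃ v ∈ S, ∃ C : Finset V, C.card ≤ k ∧ ∀ w ∈ S, G.Adj v w → w ∈ C) :
    IsDegenerate G k := by
  intro S hS
  obtain ⟨v, hv, C, hC, hvC⟩ := h S hS
  refine ⟨⟨v, hv⟩, ?_⟩
  rw [← Subtype.val_injective.encard_image]
  calc (Subtype.val '' (G.induce S).neighborSet ⟨v, hv⟩).encard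
      ≤ (C : Set V).encard := by
        refine Set.encard_le_encard ?_
        rintro _ ⟨w, hw, rfl⟩
        exact hvC w w.2 hw
    _ ≤ k := by
        rw [Set.encard_coe_eq_coe_finsetCard]
        exact_mod_cast hC

theorem IsDegenerate.exists_finset {V : Type*} [Finite V] {G : SimpleGraph V} {k : ℕ}
    (h : IsDegenerate G k) {S : Set V} (hS : S.Nonempty) :
    ∃ v ∈ S, ∃ C : Finset V, C.card ≤ k ∧ ∀ w ∈ S, G.Adj v w → w ∈ C := by
  obtain ⟨v, hv⟩ := h S hS
  have hfin : (Subtype.val '' (G.induce S).neighborSet v).Finite := Set.toFinite _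
  refine ⟨v, v.2, hfin.toFinset, ?_, fun w hw hvw => ?_⟩
  · rw [← Subtype.val_injective.encard_image, hfin.encard_eq_coe_toFinset_card] at hv
    exact_mod_cast hv
  · rw [Set.Finite.mem_toFinset]
    exact ⟨⟨w, hw⟩, hvw, rfl⟩

theorem IsDegenerate.map {V W : Type*} [Finite V] {G : SimpleGraph V} {k : ℕ}
    (h : IsDegenerate G k) (f : V ↪ W) : IsDegenerate (G.map f) k := by
  refine isDegenerate_of_forall fun S hS => ?_
  by_cases hf : (f ⁻¹' S).Nonempty
  · obtain ⟨v, hv, C, hC, hvC⟩ := h.exists_finset hf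
    refine ⟨f v, hv, C.map f, by rwa [Finset.card_map], fun w hw hvw => ?_⟩
    obtain ⟨v', w', hadj, hv', rfl⟩ := (SimpleGraph.map_adj _ _ _ _).1 hvw
    obtain rfl := f.injective hv'
    exact Finset.mem_map_of_mem f (hvC w' hw hadj)
  · obtain ⟨v, hv⟩ := hS
    refine ⟨v, hv, ∅, by simp, fun w hw hvw => ?_⟩
    obtain ⟨v', w', -, rfl, -⟩ := (SimpleGraph.map_adj _ _ _ _).1 hvw
    exact absurd ⟨v', hv⟩ hf

theorem IsDegenerate.card_le_of_isClique {V : Type*} [Finite V] {G : SimpleGraph V} {k : ℕ}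
    (h : IsDegenerate G k) {C : Finset V} (hC : G.IsClique C) : C.card ≤ k + 1 := by
  classical
  rcases C.eq_empty_or_nonempty with rfl | hne
  · simp
  obtain ⟨v, hv, D, hD, hvD⟩ := h.exists_finset (S := (C : Set V)) hne
  have hsub : C.erase v ⊆ D := fun w hw =>
    hvD w (Finset.mem_of_mem_erase hw)
      (hC hv (Finset.mem_of_mem_erase hw) (Finset.ne_of_mem_erase hw).symm)
  have := Finset.card_le_card hsub
  rw [Finset.card_erase_of_mem hv] at this
  omega

theorem degeneracy_eq_of_isClique {V : Type*} [Finite V] {G : SimpleGraph V} {k : ℕ}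
    (h : IsDegenerate G k) {C : Finset V} (hC : G.IsClique C) (hk : C.card = k + 1) :
    degeneracy G = k := by
  refine le_antisymm (Nat.sInf_le h) (le_csInf ⟨k, h⟩ fun m hm => ?_)
  have := IsDegenerate.card_le_of_isClique hm hC
  omega

/-! ### The graphs of the reduction from `INDEX` -/

/-- `p` blocks of size `l`, then `2 p` blocks of size `l` forming `p` pairs, then `k` further
vertices. -/
abbrev Vertex (p l k : ℕ) := (Fin p × Fin l) ⊕ (Bool × Fin p × Fin l) ⊕ Fin k

section Gadget

variable {p l k : ℕ}

/-- Adjacency in the graph encoding the bits `x`: the `i`-th block on the left is completely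
joined to block number `x (i, j)` of the `j`-th pair on the right. -/
def encodingAdj (x : Fin p × Fin p → Bool) : Vertex p l k → Vertex p l k → Prop
  | .inl a, .inr (.inl b) => x (a.1, b.2.1) = b.1
  | .inr (.inl b), .inl a => x (a.1, b.2.1) = b.1
  | _, _ => False

theorem encodingAdj_symm (x : Fin p × Fin p → Bool) {v w : Vertex p l k}
    (h : encodingAdj x v w) : encodingAdj x w v := by
  rcases v with a | b | t <;> rcases w with a' | b' | t' <;> exact h

theorem encodingAdj_irrefl (x : Fin p × Fin p → Bool) (v : Vertex p l k) :
    ¬ encodingAdj x v v := by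
  rcases v with a | b | t <;> exact id

/-- The vertices relevant to the bit `e`. -/
def queryVertices (e : Fin p × Fin p) : Finset (Vertex p l k) :=
  Finset.disjSum ({e.1} ×ˢ Finset.univ)
    (Finset.disjSum (Finset.univ ×ˢ ({e.2} ×ˢ Finset.univ)) Finset.univ)

/-- `v` and `w` lie on different sides of the encoding graph. -/
def Crossing : Vertex p l k → Vertex p l k → Prop
  | .inl _, .inr (.inl _) => True
  | .inr (.inl _), .inl _ => True
  | _, _ => False

theorem Crossing.symm {v w : Vertex p l k} (h : Crossing v w) : Crossing w v := by
  rcases v with a | b | t <;> rcases w with a' | b' | t' <;> exact h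

theorem encodingAdj.crossing {x : Fin p × Fin p → Bool} {v w : Vertex p l k}
    (h : encodingAdj x v w) : Crossing v w := by
  rcases v with a | b | t <;> rcases w with a' | b' | t' <;> trivial

/-- The graph encoding the bits `x`. -/
def encodingGraph (x : Fin p × Fin p → Bool) : SimpleGraph (Vertex p l k) where
  Adj := encodingAdj x
  symm := ⟨fun _ _ => encodingAdj_symm x⟩
  loopless := ⟨encodingAdj_irrefl x⟩

/-- The graph querying the bit `e`: all non-crossing edges between the relevant vertices. -/
def queryGraph (e : Fin p × Fin p) : SimpleGraph (Vertex p l k) where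
  Adj v w := v ≠ w ∧ v ∈ queryVertices e ∧ w ∈ queryVertices e ∧ ¬ Crossing v w
  symm := ⟨fun _ _ h => ⟨h.1.symm, h.2.2.1, h.2.1, fun hc => h.2.2.2 hc.symm⟩⟩
  loopless := ⟨fun _ h => h.1 rfl⟩

/-- The relevant vertices on the left, those of the block joined to them, and the
`k` extra vertices. -/
def queryClique (x : Fin p × Fin p → Bool) (e : Fin p × Fin p) : Finset (Vertex p l k) :=
  Finset.disjSum ({e.1} ×ˢ Finset.univ)
    (Finset.disjSum ({x e} ×ˢ ({e.2} ×ˢ Finset.univ)) Finset.univ)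

/-- The relevant vertices on the right and the `k` extra vertices. -/
def queryRight (e : Fin p × Fin p) : Finset (Vertex p l k) :=
  Finset.disjSum ∅ (Finset.disjSum (Finset.univ ×ˢ ({e.2} ×ˢ Finset.univ)) Finset.univ)

theorem card_queryVertices (e : Fin p × Fin p) :
    (queryVertices e : Finset (Vertex p l k)).card = k + 3 * l := by
  simp [queryVertices]; ring

theorem card_queryClique (x : Fin p × Fin p → Bool) (e : Fin p × Fin p) :
    (queryClique x e : Finset (Vertex p l k)).card = k + 2 * l := by
  simp [queryClique]; ring

theorem card_queryRight (e : Fin p × Fin p) :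
    (queryRight e : Finset (Vertex p l k)).card = k + 2 * l := by
  simp [queryRight]; ring

theorem isClique_queryClique (x : Fin p × Fin p → Bool) (e : Fin p × Fin p) :
    (encodingGraph x ⊔ queryGraph e : SimpleGraph (Vertex p l k)).IsClique
      (queryClique x e : Finset (Vertex p l k)) := by
  obtain ⟨i₀, j₀⟩ := e
  rintro v hv w hw hne
  rcases v with ⟨i, t⟩ | ⟨c, j, t⟩ | t <;> rcases w with ⟨i', t'⟩ | ⟨c', j', t'⟩ | t' <;>
    simp only [queryClique, Finset.mem_coe, Finset.inl_mem_disjSum, Finset.inr_mem_disjSum,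
      Finset.mem_product, Finset.mem_singleton, Finset.mem_univ, and_true] at hv hw <;>
    simp [encodingGraph, queryGraph, queryVertices, encodingAdj, Crossing, hv, hw] <;>
    simpa [hv, hw] using hne

/-- A vertex irrelevant to the query has only encoding edges, hence at most `p * l` neighbours. If
all of `S` is relevant, a left vertex in `S` has its neighbours in `queryClique`; if there is no
left vertex, `S` lies in `queryRight`. Both sets have size `k + 2 * l`, and the vertex itself is
excluded. -/
theorem isDegenerate_encodingGraph_sup_queryGraph (hpl : p * l + 1 ≤ k + 2 * l)
    (x : Fin p × Fin p → Bool) (e : Fin p × Fin p) :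
    IsDegenerate (encodingGraph x ⊔ queryGraph e : SimpleGraph (Vertex p l k))
      (k + 2 * l - 1) := by
  classical
  refine isDegenerate_of_forall fun S hS => ?_
  by_cases hout : ∃ v ∈ S, v ∉ queryVertices e
  · obtain ⟨v, hvS, hv⟩ := hout
    refine ⟨v, hvS, ?_⟩
    rcases v with ⟨i, t⟩ | ⟨c, j, t⟩ | t
    · refine ⟨Finset.univ.image fun q : Fin p × Fin l => .inr (.inl (x (i, q.1), q.1, q.2)),
        Finset.card_image_le.trans (by simp; omega), ?_⟩
      rintro (⟨i', t'⟩ | ⟨c', j', t'⟩ | t') - hadj <;>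
        simp_all [encodingGraph, queryGraph, queryVertices, encodingAdj]
    · refine ⟨Finset.univ.image fun q : Fin p × Fin l => .inl q,
        Finset.card_image_le.trans (by simp; omega), ?_⟩
      rintro (⟨i', t'⟩ | ⟨c', j', t'⟩ | t') - hadj <;>
        simp_all [encodingGraph, queryGraph, queryVertices, encodingAdj]
    · simp [queryVertices] at hv
  push Not at hout
  by_cases hleft : ∃ a, Sum.inl a ∈ S
  · obtain ⟨⟨i, t⟩, hvS⟩ := hleft
    have hv := hout _ hvS
    refine ⟨_, hvS, (queryClique x e).erase (.inl (i, t)), ?_, ?_⟩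
    · rw [Finset.card_erase_of_mem, card_queryClique]
      simpa [queryVertices, queryClique] using hv
    · rintro w hw hadj
      have hw' := hout w hw
      refine Finset.mem_erase.2 ⟨hadj.ne', ?_⟩
      rcases w with ⟨i', t'⟩ | ⟨c', j', t'⟩ | t' <;>
        simp_all [encodingGraph, queryGraph, queryVertices, queryClique, encodingAdj, Crossing]
      rw [← hadj, ← hw', ← hv]
  · push Not at hleft
    obtain ⟨v, hvS⟩ := hS
    have hsub : ∀ w ∈ S, w ∈ queryRight e := by
      intro w hw
      have hw' := hout w hw
      rcases w with ⟨i', t'⟩ | ⟨c', j', t'⟩ | t' <;> simp_all [queryVertices, queryRight]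
    refine ⟨v, hvS, (queryRight e).erase v, ?_, fun w hw hadj =>
      Finset.mem_erase.2 ⟨hadj.ne', hsub w hw⟩⟩
    rw [Finset.card_erase_of_mem (hsub v hvS), card_queryRight]

theorem degeneracy_map_encodingGraph_sup_queryGraph {W : Type*} [Finite W]
    (hpl : p * l + 1 ≤ k + 2 * l) (hl : 1 ≤ l) (x : Fin p × Fin p → Bool) (e : Fin p × Fin p)
    (f : Vertex p l k ↪ W) :
    degeneracy ((encodingGraph x ⊔ queryGraph e).map f) = k + 2 * l - 1 := by
  refine degeneracy_eq_of_isClique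
    ((isDegenerate_encodingGraph_sup_queryGraph hpl x e).map f)
    (C := (queryClique x e).map f) ?_ ?_
  · rw [Finset.coe_map]
    exact (isClique_queryClique x e).map
  · rw [Finset.card_map, card_queryClique]
    omega

/-- A proper colouring with too few colours for the relevant vertices to have distinct colours
reveals the queried bit. -/
theorem exists_color_eq_iff {W : Type*} (hl : 1 ≤ l) (x : Fin p × Fin p → Bool)
    (e : Fin p × Fin p) (f : Vertex p l k ↪ W) {g : W → ℕ}
    (hg : IsProperColoring ((encodingGraph x ⊔ queryGraph e).map f) (k + 3 * l - 1) g) :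
    (∃ t t', g (f (.inl (e.1, t))) = g (f (.inr (.inl (false, e.2, t'))))) ↔ x e = true := by
  have hadj : ∀ v w, (encodingGraph x ⊔ queryGraph e).Adj v w → g (f v) ≠ g (f w) :=
    fun v w h => hg.2 _ _ ((SimpleGraph.map_adj _ _ _ _).2 ⟨v, w, h, rfl, rfl⟩)
  constructor
  · rintro ⟨t, t', htt⟩
    by_contra hx
    exact hadj _ _ (Or.inl (by simpa [encodingGraph, encodingAdj] using hx)) htt
  · intro hx
    -- Pigeonhole on the relevant vertices. The case split below leaves only a left vertex paired
    -- with a vertex of the unjoined block, which is the block `false` since the bit is `true`.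
    obtain ⟨v, hv, w, hw, hne, hvw⟩ := Finset.exists_ne_map_eq_of_card_lt_of_maps_to
      (s := (queryVertices e : Finset (Vertex p l k))) (t := Finset.range (k + 3 * l - 1))
      (f := fun v => g (f v)) (by rw [card_queryVertices, Finset.card_range]; omega)
      (fun v _ => by simpa using hg.1 (f v))
    have hnadj : ¬ (encodingGraph x ⊔ queryGraph e).Adj v w := fun h => hadj v w h hvw
    clear hadj hg
    obtain ⟨i₀, j₀⟩ := e
    rcases v with ⟨i, t⟩ | ⟨c, j, t⟩ | t <;> rcases w with ⟨i', t'⟩ | ⟨c', j', t'⟩ | t' <;>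
      simp only [queryVertices, Finset.inl_mem_disjSum, Finset.inr_mem_disjSum,
        Finset.mem_product, Finset.mem_singleton, Finset.mem_univ, and_true, true_and] at hv hw <;>
      simp [encodingGraph, queryGraph, queryVertices, encodingAdj, Crossing, hv, hw] at hnadj hne
    · exact absurd hnadj hne
    · rw [hx] at hnadj
      subst hv hw
      exact ⟨t, t', by rwa [show c' = false by cases c' <;> simp_all] at hvw⟩
    · rw [hx] at hnadj
      subst hv hw
      exact ⟨t', t, by
        rw [show c = false by cases c <;> simp_all] at hvw
        exact hvw.symm⟩
    · exact absurd hnadj.2 (hne hnadj.1)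
    · exact absurd hnadj hne

end Gadget

/-! ### Edge streams -/

theorem exists_isEdgeStream {V : Type*} [Finite V] (G : SimpleGraph V) :
    ∃ σ, IsEdgeStream G σ := by
  refine ⟨(Set.toFinite G.edgeSet).toFinset.toList, Finset.nodup_toList _, fun e => ?_⟩
  rw [Finset.mem_toList, Set.Finite.mem_toFinset]

theorem IsEdgeStream.append {V : Type*} {G H : SimpleGraph V} {σ τ : List (Sym2 V)}
    (hσ : IsEdgeStream G σ) (hτ : IsEdgeStream H τ) (hGH : Disjoint G.edgeSet H.edgeSet) :
    IsEdgeStream (G ⊔ H) (σ ++ τ) := by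
  refine ⟨hσ.1.append hτ.1 fun e he he' =>
    Set.disjoint_left.1 hGH ((hσ.2 e).1 he) ((hτ.2 e).1 he'), fun e => ?_⟩
  rw [List.mem_append, hσ.2, hτ.2, SimpleGraph.edgeSet_sup, Set.mem_union]

theorem IsEdgeStream.map {V W : Type*} {G : SimpleGraph V} {σ : List (Sym2 V)}
    (hσ : IsEdgeStream G σ) (f : V ↪ W) : IsEdgeStream (G.map f) (σ.map f.sym2Map) := by
  refine ⟨hσ.1.map f.sym2Map.injective, fun e => ?_⟩
  rw [List.mem_map, SimpleGraph.edgeSet_map]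
  exact exists_congr fun e' => and_congr_left fun _ => hσ.2 e'

section Gadget

variable {p l k : ℕ}

/-- The edges of the encoding graph in an arbitrary order; their number does not depend
on the encoded bits. -/
noncomputable def encodingStream (x : Fin p × Fin p → Bool) : List (Sym2 (Vertex p l k)) :=
  (Finset.univ : Finset ((Fin p × Fin p) × (Fin l × Fin l))).toList.map fun q =>
    s(.inl (q.1.1, q.2.1), .inr (.inl (x q.1, q.1.2, q.2.2)))

theorem length_encodingStream (x : Fin p × Fin p → Bool) :
    (encodingStream x : List (Sym2 (Vertex p l k))).length = p * p * (l * l) := by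
  simp [encodingStream]

theorem isEdgeStream_encodingStream (x : Fin p × Fin p → Bool) :
    IsEdgeStream (encodingGraph x : SimpleGraph (Vertex p l k)) (encodingStream x) := by
  refine ⟨(Finset.nodup_toList _).map ?_, ?_⟩
  · rintro ⟨⟨i, j⟩, t, t'⟩ ⟨⟨i', j'⟩, u, u'⟩ h
    simp only [Sym2.eq_iff, Sum.inl.injEq, Sum.inr.injEq, Prod.mk.injEq, reduceCtorEq,
      false_and, or_false] at h
    simp [h]
  · rintro ⟨v, w⟩
    change s(v, w) ∈ _ ↔ s(v, w) ∈ _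
    simp only [encodingStream, List.mem_map, Finset.mem_toList, Finset.mem_univ, true_and,
      SimpleGraph.mem_edgeSet]
    constructor
    · rintro ⟨q, hq⟩
      rcases Sym2.eq_iff.1 hq with ⟨rfl, rfl⟩ | ⟨rfl, rfl⟩ <;> exact rfl
    · intro h
      rcases v with a | b | t <;> rcases w with a' | b' | t'
      · exact h.elim
      · refine ⟨((a.1, b'.2.1), (a.2, b'.2.2)), ?_⟩
        have h' : x (a.1, b'.2.1) = b'.1 := h
        rw [h']
      · exact h.elim
      · refine ⟨((a'.1, b.2.1), (a'.2, b.2.2)), ?_⟩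
        have h' : x (a'.1, b.2.1) = b.1 := h
        rw [h', Sym2.eq_swap]
      all_goals exact h.elim

/-- The edges of the query graph in an arbitrary order. -/
noncomputable def queryStream (e : Fin p × Fin p) : List (Sym2 (Vertex p l k)) :=
  (exists_isEdgeStream (queryGraph e)).choose

theorem isEdgeStream_encodingStream_append_queryStream (x : Fin p × Fin p → Bool)
    (e : Fin p × Fin p) :
    IsEdgeStream (encodingGraph x ⊔ queryGraph e : SimpleGraph (Vertex p l k))
      (encodingStream x ++ queryStream e) := by
  refine (isEdgeStream_encodingStream x).append (exists_isEdgeStream (queryGraph e)).choose_spec ?_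
  rw [Set.disjoint_left]
  rintro ⟨v, w⟩ h h'
  exact h'.2.2.2 (encodingAdj.crossing h)

end Gadget

/-! ### Lower bounds for streaming algorithms -/

/-- The memory after reading `σ`. -/
def DetAlgorithm.stateAfter {n s : ℕ} (A : DetAlgorithm n s) (κ : ℕ) (σ : List (Sym2 (Fin n))) :
    Fin s → Bool :=
  σ.zipIdx.foldl (fun q e => A.step κ e.2 q e.1) (A.init κ)

/-- The output if the memory is `q` at position `t`, where the remaining stream is `τ`. -/
def DetAlgorithm.runFrom {n s : ℕ} (A : DetAlgorithm n s) (κ t : ℕ) (q : Fin s → Bool)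
    (τ : List (Sym2 (Fin n))) : Fin n → ℕ :=
  A.output κ ((τ.zipIdx t).foldl (fun q e => A.step κ e.2 q e.1) q)

theorem DetAlgorithm.run_append {n s : ℕ} (A : DetAlgorithm n s) (κ : ℕ)
    (σ τ : List (Sym2 (Fin n))) :
    A.run κ (σ ++ τ) = A.runFrom κ σ.length (A.stateAfter κ σ) τ := by
  simp [DetAlgorithm.run, DetAlgorithm.runFrom, DetAlgorithm.stateAfter, List.zipIdx_append]

/-- The algorithm produces proper `c`-colourings of graphs of degeneracy `κ`
with probability at least `2 / 3`. -/
def RandAlgorithm.ColorsWith {n s : ℕ} (A : RandAlgorithm.{u} n s) (κ c : ℕ) : Prop :=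
  ∀ G : SimpleGraph (Fin n), degeneracy G = κ →
    ∀ σ : List (Sym2 (Fin n)), IsEdgeStream G σ →
      letI := A.measurableSpace
      (2 / 3 : ℝ) ≤ A.μ.real {ω | IsProperColoring G c ((A.alg ω).run κ σ)}

theorem RandAlgorithm.ColorsWith.mono {n s : ℕ} {A : RandAlgorithm.{u} n s} {κ c c' : ℕ}
    (h : A.ColorsWith κ c) (hc : c ≤ c') : A.ColorsWith κ c' := by
  intro G hG σ hσ
  let _ := A.measurableSpace
  have := A.isProbabilityMeasure
  exact (h G hG σ hσ).trans
    (measureReal_mono fun ω hω => ⟨fun v => (hω.1 v).trans_le hc, hω.2⟩)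

theorem RandAlgorithm.ColorsWith.sq_div_le {n s : ℕ} {A : RandAlgorithm.{u} n s} {p l k : ℕ}
    (hA : A.ColorsWith (k + 2 * l - 1) (k + 3 * l - 1)) (hl : 1 ≤ l)
    (hpl : p * l + 1 ≤ k + 2 * l) (hn : 3 * (p * l) + k ≤ n) :
    (p : ℝ) ^ 2 / 15 ≤ s := by
  classical
  let _ := A.measurableSpace
  have := A.isProbabilityMeasure
  obtain ⟨f⟩ : Nonempty (Vertex p l k ↪ Fin n) :=
    Function.Embedding.nonempty_of_card_le (by simp; linarith)
  set κ := k + 2 * l - 1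
  let G : (Fin p × Fin p → Bool) → Fin p × Fin p → SimpleGraph (Fin n) :=
    fun x e => (encodingGraph x ⊔ queryGraph e).map f
  let σ : (Fin p × Fin p → Bool) → List (Sym2 (Fin n)) :=
    fun x => (encodingStream x).map f.sym2Map
  let τ : Fin p × Fin p → List (Sym2 (Fin n)) := fun e => (queryStream e).map f.sym2Map
  -- The algorithm may consult the position, so the decoder can resume the run only because this
  -- length is the same for every string.
  have hσ : ∀ x, (σ x).length = p * p * (l * l) := fun x => by
    rw [List.length_map, length_encodingStream]
  have hστ : ∀ x e, IsEdgeStream (G x e) (σ x ++ τ e) := fun x e => by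
    have := (isEdgeStream_encodingStream_append_queryStream x e).map f
    rwa [List.map_append] at this
  have key := card_div_le_of_index_protocol A.μ (ι := Fin p × Fin p)
    (fun ω x => (A.alg ω).stateAfter κ (σ x))
    (fun ω q e => decide (∃ t t',
      (A.alg ω).runFrom κ (p * p * (l * l)) q (τ e) (f (.inl (e.1, t))) =
      (A.alg ω).runFrom κ (p * p * (l * l)) q (τ e) (f (.inr (.inl (false, e.2, t'))))))
    (fun x e => {ω | IsProperColoring (G x e) (k + 3 * l - 1) ((A.alg ω).run κ (σ x ++ τ e))})
    (fun x e => A.measurable_run κ (σ x ++ τ e)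
      (MeasurableSet.of_discrete (s := {g | IsProperColoring (G x e) (k + 3 * l - 1) g})))
    (fun x e => hA _ (degeneracy_map_encodingGraph_sup_queryGraph hpl hl x e f) _ (hστ x e))
    (fun x e ω hω => by
      have h := exists_color_eq_iff hl x e f hω
      rw [DetAlgorithm.run_append, hσ] at h
      rw [Bool.eq_iff_iff, decide_eq_true_iff]
      exact h)
  have hcard : (Fintype.card (Fin p × Fin p) : ℝ) = (p : ℝ) ^ 2 := by
    simp [sq]
  rwa [hcard] at key

theorem RandAlgorithm.Colors.colorsWith {n s : ℕ} {A : RandAlgorithm.{u} n s} {lam : ℕ → ℕ}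
    (h : A.Colors lam) (κ : ℕ) : A.ColorsWith κ (κ + lam κ) :=
  fun G hG σ hσ => h G κ hG σ hσ

theorem RandAlgorithm.Colors.sq_div_sq_le {n s l : ℕ} {A : RandAlgorithm.{u} n s}
    (h : A.Colors fun _ => l) (hl : 1 ≤ l) (hn : 4 * l ≤ n) :
    (1 / 960 : ℝ) * ((n : ℝ) ^ 2 / (l : ℝ) ^ 2) ≤ s := by
  set p := n / (4 * l) with hp
  have hp1 : 1 ≤ p := (Nat.one_le_div_iff (by omega)).2 hn
  have hpn : p * (4 * l) ≤ n := Nat.div_mul_le_self _ _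
  have hnp : n < (p + 1) * (4 * l) := by
    have := Nat.lt_mul_div_succ n (show 0 < 4 * l by omega)
    rw [mul_comm]
    exact this
  -- With `k = (p - 1) * l` extra vertices the gadget has at most `4 * p * l ≤ n` vertices, and `p *
  -- l + 1 ≤ k + 2 * l` reduces to `1 ≤ l`.
  obtain ⟨r, hr⟩ : ∃ r, p = r + 1 := ⟨p - 1, by omega⟩
  have hA : A.ColorsWith (r * l + 2 * l - 1) (r * l + 3 * l - 1) := by
    have := h.colorsWith (r * l + 2 * l - 1)
    convert this using 1
    omega
  have hkey := hA.sq_div_le (p := p) hl (by rw [hr]; linarith) (by rw [hr] at hpn ⊢; nlinarith)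
  have hl0 : (0 : ℝ) < l := by exact_mod_cast hl
  -- Rounding down costs at most a factor 2 as `p ≥ 1`, hence the constant `8 ^ 2 * 15 = 960`.
  have hnp' : (n : ℝ) ≤ p * (8 * l) := by
    have h1 : n ≤ p * (8 * l) := by nlinarith
    exact_mod_cast h1
  have hdiv : (n : ℝ) / l ≤ 8 * p := by
    rw [div_le_iff₀ hl0]
    linarith
  have hsq : ((n : ℝ) / l) ^ 2 ≤ (8 * p) ^ 2 := pow_le_pow_left₀ (by positivity) hdiv 2
  rw [← div_pow]
  linarith

open Filter in
theorem IsSemiStreaming.exists_le_rpow {s : ℕ → ℕ} (hs : IsSemiStreaming s) {δ : ℝ}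
    (hδ : 0 < δ) : ∃ C : ℝ, 0 < C ∧ ∀ᶠ n : ℕ in atTop, (s n : ℝ) ≤ C * ((n : ℝ) * (n : ℝ) ^ δ) := by
  obtain ⟨d, hd⟩ := hs
  have hlog : (fun n : ℕ => Real.log n ^ d) =O[atTop] fun n : ℕ => (n : ℝ) ^ δ := by
    have := ((isLittleO_log_rpow_rpow_atTop (d : ℝ) hδ).comp_tendsto
      tendsto_natCast_atTop_atTop).isBigO
    simpa [Function.comp_def] using this
  obtain ⟨C, hC, h⟩ :=
    (hd.trans ((Asymptotics.isBigO_refl (fun n : ℕ => (n : ℝ)) atTop).mul hlog)).exists_pos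
  refine ⟨C, hC, h.bound.mono fun n hn => ?_⟩
  rwa [Real.norm_natCast, Real.norm_of_nonneg (by positivity)] at hn

/-- The degeneracy is prescribed here, so `k = m + 1 - 2 * l` is forced and `p = m / l` is the
largest admissible value; the gadget then fits into `4 * m` vertices. -/
theorem RandAlgorithm.ColorsWith.sq_le_of_four_mul {m s l : ℕ} {A : RandAlgorithm.{u} (4 * m) s}
    (hA : A.ColorsWith m (m + l)) (hl : 1 ≤ l) (hlm : 2 * l ≤ m) :
    (m : ℝ) ^ 2 ≤ 60 * (l : ℝ) ^ 2 * s := by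
  obtain ⟨k, hk⟩ : ∃ k, m + 1 = k + 2 * l := ⟨m + 1 - 2 * l, by omega⟩
  have hpl : m / l * l ≤ m := Nat.div_mul_le_self _ _
  have hp1 : 1 ≤ m / l := (Nat.one_le_div_iff (by omega)).2 (by omega)
  have hmp : m < l * (m / l + 1) := Nat.lt_mul_div_succ m (by omega)
  have hA' : A.ColorsWith (k + 2 * l - 1) (k + 3 * l - 1) := by
    convert hA using 1 <;> omega
  have hkey := hA'.sq_div_le (p := m / l) hl (by omega) (by omega)
  have h1 : m ≤ 2 * l * (m / l) := by nlinarith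
  have h2 : (m : ℝ) ≤ 2 * l * (m / l : ℕ) := by exact_mod_cast h1
  calc (m : ℝ) ^ 2 ≤ (2 * l * (m / l : ℕ)) ^ 2 := pow_le_pow_left₀ (by positivity) h2 2
    _ = 60 * (l : ℝ) ^ 2 * ((m / l : ℕ) ^ 2 / 15) := by ring
    _ ≤ 60 * (l : ℝ) ^ 2 * s := by gcongr

open Filter in
theorem not_isSemiStreaming_of_colors {γ : ℝ} (hγ : 0 < γ) {lam : ℕ → ℕ → ℕ} {K : ℝ} {κ₀ : ℕ}
    (hlam : ∀ n κ : ℕ, κ₀ ≤ κ → (lam n κ : ℝ) ≤ K * (κ : ℝ) ^ (1 / 2 - γ)) {s : ℕ → ℕ}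
    (A : (n : ℕ) → RandAlgorithm.{u} n (s n)) (hA : ∀ n, (A n).Colors (lam n)) :
    ¬ IsSemiStreaming s := by
  intro hs
  -- Capping `δ` at `1 / 2` keeps the exponent `1 / 2 - δ` nonnegative, so the bound on the slack
  -- also covers the value 1.
  obtain ⟨δ, hδ, hδγ, hδ2⟩ : ∃ δ : ℝ, 0 < δ ∧ δ ≤ γ ∧ δ ≤ 1 / 2 :=
    ⟨min γ (1 / 2), by positivity, min_le_left _ _, min_le_right _ _⟩
  obtain ⟨M, hM1, hKM⟩ : ∃ M : ℝ, 1 ≤ M ∧ K ≤ M := ⟨max 1 K, le_max_left _ _, le_max_right _ _⟩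
  obtain ⟨C, hC, hsC⟩ := hs.exists_le_rpow hδ
  have hfour : Tendsto (fun m : ℕ => 4 * m) atTop atTop :=
    tendsto_id.const_mul_atTop' (by norm_num)
  have hlarge : ∀ a : ℝ, ∀ b : ℝ, 0 < b → ∀ᶠ m : ℕ in atTop, a < (m : ℝ) ^ b := fun a b hb =>
    ((tendsto_rpow_atTop hb).comp tendsto_natCast_atTop_atTop).eventually_gt_atTop a
  obtain ⟨m, hm, hmκ, hm1, hm2, hm3⟩ := ((hfour.eventually hsC).and
    ((eventually_ge_atTop κ₀).and ((eventually_ge_atTop 1).and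
      ((hlarge (2 * M) (1 / 2 + δ) (by positivity)).and
        (hlarge (60 * M ^ 2 * (C * (4 * 4 ^ δ))) δ hδ))))).exists
  have hm0 : (0 : ℝ) < m := by exact_mod_cast hm1
  have hm1' : (1 : ℝ) ≤ m := by exact_mod_cast hm1
  -- The gadget needs nonempty blocks, while the slack may be 0; enlarging the palette is harmless.
  set l := max 1 (lam (4 * m) m) with hl
  have hlM : (l : ℝ) ≤ M * (m : ℝ) ^ (1 / 2 - δ) := by
    have hpow : (1 : ℝ) ≤ (m : ℝ) ^ (1 / 2 - δ) := Real.one_le_rpow hm1' (by linarith)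
    rw [hl, Nat.cast_max, Nat.cast_one]
    refine max_le (by nlinarith) ((hlam (4 * m) m hmκ).trans ?_)
    exact mul_le_mul hKM (Real.rpow_le_rpow_of_exponent_le hm1' (by linarith))
      (by positivity) (by positivity)
  have hlm : 2 * l ≤ m := by
    have : (2 : ℝ) * l ≤ m := by
      calc (2 : ℝ) * l ≤ 2 * M * (m : ℝ) ^ (1 / 2 - δ) := by linarith
        _ ≤ (m : ℝ) ^ (1 / 2 + δ) * (m : ℝ) ^ (1 / 2 - δ) := by gcongr
        _ = m := by
          rw [← Real.rpow_add hm0]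
          norm_num
    exact_mod_cast this
  have hcol : (A (4 * m)).ColorsWith m (m + l) :=
    ((hA (4 * m)).colorsWith m).mono (by omega)
  have hkey := hcol.sq_le_of_four_mul (le_max_left _ _) hlm
  have hl2 : (l : ℝ) ^ 2 * (m : ℝ) ^ (2 * δ) ≤ M ^ 2 * m := by
    calc (l : ℝ) ^ 2 * (m : ℝ) ^ (2 * δ)
        ≤ (M * (m : ℝ) ^ (1 / 2 - δ)) ^ 2 * (m : ℝ) ^ (2 * δ) := by gcongr
      _ = M ^ 2 * m := by
        rw [mul_pow, ← Real.rpow_natCast ((m : ℝ) ^ (1 / 2 - δ)), ← Real.rpow_mul hm0.le,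
          mul_assoc, ← Real.rpow_add hm0]
        norm_num
        left
        rw [show (1 / 2 - δ) * 2 + 2 * δ = 1 by ring, Real.rpow_one]
  have hδδ : (m : ℝ) ^ (2 * δ) = (m : ℝ) ^ δ * (m : ℝ) ^ δ := by
    rw [← Real.rpow_add hm0, two_mul]
  have hsm : (s (4 * m) : ℝ) ≤ C * (4 * 4 ^ δ) * (m * (m : ℝ) ^ δ) := by
    refine hm.trans (le_of_eq ?_)
    push_cast
    rw [Real.mul_rpow (by norm_num) hm0.le]
    ring
  -- Up to constants, `m ^ 2 ≤ l ^ 2 * s ≤ m ^ (1 - 2 * δ) * m ^ (1 + δ) = m ^ (2 - δ)`, which fails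
  -- for large `m`.
  have hfinal : (m : ℝ) ^ 2 * (m : ℝ) ^ δ * (m : ℝ) ^ δ ≤
      (m : ℝ) ^ 2 * (m : ℝ) ^ δ * (60 * M ^ 2 * (C * (4 * 4 ^ δ))) := by
    calc (m : ℝ) ^ 2 * (m : ℝ) ^ δ * (m : ℝ) ^ δ = (m : ℝ) ^ 2 * (m : ℝ) ^ (2 * δ) := by
          rw [hδδ]; ring
      _ ≤ 60 * (l : ℝ) ^ 2 * s (4 * m) * (m : ℝ) ^ (2 * δ) := by gcongr
      _ = 60 * ((l : ℝ) ^ 2 * (m : ℝ) ^ (2 * δ)) * s (4 * m) := by ring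
      _ ≤ 60 * (M ^ 2 * m) * (C * (4 * 4 ^ δ) * (m * (m : ℝ) ^ δ)) := by gcongr
      _ = _ := by ring
  exact absurd (le_of_mul_le_mul_left hfinal (by positivity)) (not_le.2 hm3)

end StreamColoring

theorem mainTheorem3 :
    (∃ c : ℝ, 0 < c ∧
      ∀ (lam n : ℕ), 1 ≤ lam → 5 * lam ≤ n →
        ∀ (s : ℕ) (A : StreamColoring.RandAlgorithm.{u} n s),
          A.Colors (fun _ => lam) → c * ((n : ℝ) ^ 2 / (lam : ℝ) ^ 2) ≤ (s : ℝ)) ∧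
    (∀ (γ : ℝ), 0 < γ →
      ∀ lam : ℕ → ℕ → ℕ,
        (∃ (K : ℝ) (κ₀ : ℕ), ∀ n κ : ℕ, κ₀ ≤ κ →
          (lam n κ : ℝ) ≤ K * (κ : ℝ) ^ (1 / 2 - γ)) →
        ¬ ∃ s : ℕ → ℕ, StreamColoring.IsSemiStreaming s ∧
          ∃ A : (n : ℕ) → StreamColoring.RandAlgorithm.{u} n (s n),
            ∀ n, (A n).Colors (lam n)) := by
  refine ⟨⟨1 / 960, by norm_num, fun lam n hlam hn s A hA =>
    hA.sq_div_sq_le hlam (by omega)⟩, ?_⟩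
  rintro γ hγ lam ⟨K, κ₀, hlam⟩ ⟨s, hs, A, hA⟩
  exact StreamColoring.not_isSemiStreaming_of_colors hγ hlam A hA hs
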